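/- **Setting.** Let $\delta>0$ and $\lambda\in[0,1)$. Let $(\alpha,S)$ represent a phase-type job size distribution with $n$ phases and mean one: $\alpha$ is a probability (row) vector, $S$ is an invertible $n\times n$ matrix with nonnegative off-diagonal entries and $s^*:=-S\mathbf 1\ge 0$, and $\alpha(-S)^{-1}\mathbf 1=1$. Put $$y=\alpha(\delta I-S)^{-1}s^*,\qquad \tilde m=\frac{\log\left(\frac1y+\left(\frac{\lambda}{\delta(1-\lambda)}-1\right)\frac{1-y}{y}\right)}{\log(1/y)},\qquad \lambda_k=\frac{\delta y(1-y^k)}{\delta y(1-y^k)+y^k(1-y)}\quad(k\in\mathbb N=\{0,1,2,\dots\}).$$ For $m\in\mathbb N$ and $\nu\ge0$ consider the continuous-time Markov chain with states $(0,m)$, $(0,m+1)$ and $(q,e,j)$ with $e\in\{m,m+1\}$, $1\le q\le e$, $1\le j\le n$ (actual queue length $q$, estimated queue length $e$, service phase $j$) and the following jumps: * phase changes $(q,e,j)\to(q,e,j')$ at rate $S_{jj'}$ for $j'\ne j$; * service completions $(q,e,j)\to(q-1,e,j')$ at rate $s^*_j\alpha_{j'}$ if $q>1$, and $(1,e,j)\to(0,e)$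 at rate $s_j^*$; * probes $(q,e,j)\to(\max(q,m),\max(q,m),j)$ at rate $\delta$, and $(0,e)\to(m,m,j')$ at rate $\delta\alpha_{j'}$ (for $m=0$: $(0,e)\to(0,0)$ at rate $\delta$); * job assignments $(q,m,j)\to(q+1,m+1,j)$ at rate $\nu$, and $(0,m)\to(1,m+1,j')$ at rate $\nu\alpha_{j'}$. **Theorem.** Let $m\in\mathbb N$ and $\nu\ge 0$ be such that the actual queue length is zero with probability $1-\lambda$ under a stationary distribution of this chain (that is, the chain is the queue at the cavity of the push policy with arrival rate $\lambda$ and probe rate $\delta$), and let $E[Q]$ be the mean of the actual queue length under this stationary distribution. Then $$\lfloor\tilde m\rfloor-\frac{\lambda_{\lfloor\tilde m\rfloor}}{\delta}\;\le\;E[Q]\;\le\;\lceil\tilde m\rceil-\frac{\lambda_{\lceil\tilde m\rceil}}{\delta}.$$ -/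

import Mathlib

open scoped Matrix

noncomputable section

namespace PushCavity

/-- The exit rate vector `s* = -S 1`. -/
def exitRate {n : ℕ} (S : Matrix (Fin n) (Fin n) ℝ) : Fin n → ℝ :=
  -(S *ᵥ 1)

/-- `(α, S)` represents a phase-type distribution on the positive reals: `α` is a probability
vector and `S` is an invertible subgenerator. -/
structure IsPhaseType {n : ℕ} (α : Fin n → ℝ) (S : Matrix (Fin n) (Fin n) ℝ) : Prop where
  alpha_nonneg : ∀ j, 0 ≤ α j
  alpha_sum : ∑ j, α j = 1
  offDiag_nonneg : ∀ i j, i ≠ j → 0 ≤ S i j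
  exit_nonneg : ∀ j, 0 ≤ exitRate S j
  isUnit_det : IsUnit S.det

/-- The mean `α (-S)⁻¹ 1` of the phase-type distribution `(α, S)`. -/
def phMean {n : ℕ} (α : Fin n → ℝ) (S : Matrix (Fin n) (Fin n) ℝ) : ℝ :=
  α ⬝ᵥ ((-S)⁻¹ *ᵥ 1)

/-- `y = α (δ I - S)⁻¹ s*`, the probability that a job finishes service before an independent
exponential timer with rate `δ` expires. -/
def finishProb {n : ℕ} (α : Fin n → ℝ) (S : Matrix (Fin n) (Fin n) ℝ) (δ : ℝ) : ℝ :=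
  α ⬝ᵥ ((δ • (1 : Matrix (Fin n) (Fin n) ℝ) - S)⁻¹ *ᵥ exitRate S)

/-- The states of the queue at the cavity. `Sum.inl k` is the state with an empty queue and
estimated queue length `m + k`, for `k = 0, 1`. `Sum.inr ⟨k, i, j⟩` is the state with actual queue
length `i + 1 ∈ {1, …, m + k}`, estimated queue length `m + k` and service phase `j`. -/
abbrev State (m n : ℕ) : Type :=
  Fin 2 ⊕ (Σ k : Fin 2, Fin (m + k) × Fin n)

/-- The actual queue length of a state. -/
def State.queue {m n : ℕ} : State m n → ℕ
  | Sum.inl _ => 0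
  | Sum.inr ⟨_, i, _⟩ => i + 1

/-- The estimated queue length of a state. -/
def State.est {m n : ℕ} : State m n → ℕ
  | Sum.inl k => m + k
  | Sum.inr ⟨k, _, _⟩ => m + k

/-- The rate of the jumps from `s` to `t`. Below `q, e` and `q', e'` are the actual and the
estimated queue lengths of `s` and of `t`. A probe (rate `δ`) leads from `(q, e)` to
`(max q m, max q m)`, an assignment (rate `ν`) from `(q, m)` to `(q + 1, m + 1)`, a service
completion from `(q, e)` to `(q - 1, e)`. A job in service keeps its phase at a probe and at an
assignment; a job that starts service draws its phase from `α`.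
Jumps from a state to itself may have a positive rate here; they cancel in `generator`. -/
def rate {n : ℕ} (α : Fin n → ℝ) (S : Matrix (Fin n) (Fin n) ℝ) (δ : ℝ) (m : ℕ) (ν : ℝ)
    (s t : State m n) : ℝ :=
  let q := State.queue s
  let e := State.est s
  let q' := State.queue t
  let e' := State.est t
  match s, t with
  | Sum.inl _, Sum.inl _ =>
      if q' = m ∧ e' = m then δ else 0
  | Sum.inl _, Sum.inr ⟨_, _, j'⟩ =>
      (if q' = m ∧ e' = m then δ * α j' else 0)
      + (if e = m ∧ q' = 1 ∧ e' = m + 1 then ν * α j' else 0)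
  | Sum.inr ⟨_, _, j⟩, Sum.inl _ =>
      if q = 1 ∧ e' = e then exitRate S j else 0
  | Sum.inr ⟨_, _, j⟩, Sum.inr ⟨_, _, j'⟩ =>
      (if j ≠ j' ∧ q' = q ∧ e' = e then S j j' else 0)
      + (if q = q' + 1 ∧ e' = e then exitRate S j * α j' else 0)
      + (if j' = j ∧ q' = max q m ∧ e' = max q m then δ else 0)
      + (if j' = j ∧ e = m ∧ q' = q + 1 ∧ e' = m + 1 then ν else 0)

/-- The rate matrix of the queue at the cavity. -/
def generator {n : ℕ} (α : Fin n → ℝ) (S : Matrix (Fin n) (Fin n) ℝ) (δ : ℝ) (m : ℕ) (ν : ℝ) :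
    Matrix (State m n) (State m n) ℝ :=
  Matrix.of (rate α S δ m ν) - Matrix.diagonal fun s => ∑ t, rate α S δ m ν s t

/-- `p` is a stationary distribution of the rate matrix `Q`. -/
structure IsStationary {Ω : Type*} [Fintype Ω] (Q : Matrix Ω Ω ℝ) (p : Ω → ℝ) : Prop where
  nonneg : ∀ s, 0 ≤ p s
  sum_eq_one : ∑ s, p s = 1
  balance : p ᵥ* Q = 0

/-- The probability that the actual queue length equals `q`. -/
def queueProb {m n : ℕ} (p : State m n → ℝ) (q : ℕ) : ℝ :=
  ∑ s with State.queue s = q, p s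

/-- The mean actual queue length. -/
def meanQueue {m n : ℕ} (p : State m n → ℝ) : ℝ :=
  ∑ q ∈ Finset.range (m + 2), (q : ℝ) * queueProb p q

/-- `p` is the stationary law of the queue at the cavity for arrival rate `lam` and probe rate `δ`:
it is stationary for the rate matrix with parameters `m` and `ν`, and these are such that the
queue is empty with probability `1 - lam`. -/
structure IsCavityLaw {n : ℕ} (α : Fin n → ℝ) (S : Matrix (Fin n) (Fin n) ℝ) (lam δ : ℝ)
    (m : ℕ) (ν : ℝ) (p : State m n → ℝ) : Prop where
  nu_nonneg : 0 ≤ ν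
  stationary : IsStationary (generator α S δ m ν) p
  prob_empty : queueProb p 0 = 1 - lam

/-- `m̃ = log (1/y + (lam / (δ (1 - lam)) - 1) (1 - y) / y) / log (1/y)`. -/
def mTilde (lam δ y : ℝ) : ℝ :=
  Real.log (1 / y + (lam / (δ * (1 - lam)) - 1) * ((1 - y) / y)) / Real.log (1 / y)

/-- `λ_m = δ y (1 - y ^ m) / (δ y (1 - y ^ m) + y ^ m (1 - y))`. -/
def lamThreshold (δ y : ℝ) (m : ℕ) : ℝ :=
  δ * y * (1 - y ^ m) / (δ * y * (1 - y ^ m) + y ^ m * (1 - y))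

end PushCavity

end

/-!
Write `q` and `e` for the actual and the estimated queue length, `J` for the service phase, and put
`v = (δ I - S)⁻¹ s*`, so that `0 < v < 1`, `S v + s* = δ v` and `y = α v` lies in `(0, 1)`. Every
identity used about the stationary law `p` says that the mean drift of a test function vanishes
(`IsStationary.sum_drift_eq_zero`, with the drifts computed in `IsPhaseType.generator_mulVec_inl`
and `IsPhaseType.generator_mulVec_inr`).

* Functions of the phase alone give the completion rate `lam` and
  `δ E[v_J; q > 0] = lam (1 - y)`, whence `1 - y ≤ δ` if `lam > 0`.
* The function `q - e` gives `E[q] = E[e] - lam / δ = m - lam / δ + b` with `b = P(e = m + 1)`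
  (`IsCavityLaw.meanQueue_eq`).
* The probability of emptying the queue before the next probe, with an additional factor `y` where
  `e = m`, has a drift free of `ν`. This gives `y a₀ + b₀` for `a₀ = P(q = 0, e = m)` and
  `b₀ = P(q = 0, e = m + 1)` (`IsStationary.finishProb_balance`). As `a₀ + b₀ = 1 - lam`, both are
  explicit: up to positive factors `b₀` is `lam - λ_m` and also `1 - y ^ (m̃ - m)`, and `a₀` is
  `λ_{m+1} - lam` and also `1 - y ^ (m + 1 - m̃)`.

Since `a₀` and `b₀` are nonnegative, `m ≤ m̃ ≤ m + 1`. If `m̃` is one of the two ends, then `b₀` or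
`a₀` vanishes, and with it `P(e = m + 1)` or `P(e = m)` (`IsStationary.estProb_eq_zero`), and the
formula for `E[q]` equals both bounds. Otherwise the bounds amount to
`lam - λ_m ≤ δ P(e = m + 1)` and `λ_{m+1} - lam ≤ δ P(e = m)`, and follow
from the formulas for `b₀` and `a₀`, from `1 - y ≤ δ`, and from `b₀ ≤ y P(e = m + 1)` for `m ≥ 1`
(`IsStationary.prob_empty_le_finishProb_mul`).
-/

open scoped Matrix

noncomputable section

namespace PushCavity

variable {n : ℕ} {α : Fin n → ℝ} {S : Matrix (Fin n) (Fin n) ℝ}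

/-! ### The resolvent of a subgenerator -/

lemma exitRate_apply (S : Matrix (Fin n) (Fin n) ℝ) (i : Fin n) : exitRate S i = -∑ j, S i j := by
  simp [exitRate, Matrix.mulVec, dotProduct]

/-- At a minimum `i` of `x`, the off-diagonal part of `S` pushes `x` upwards. -/
lemma IsPhaseType.mulVec_ge_of_min (h : IsPhaseType α S) {x : Fin n → ℝ} {i : Fin n}
    (hi : ∀ j, x i ≤ x j) : -exitRate S i * x i ≤ (S *ᵥ x) i := by
  rw [exitRate_apply, neg_neg, Finset.sum_mul]
  refine Finset.sum_le_sum fun j _ => ?_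
  rcases eq_or_ne i j with rfl | hij
  · exact le_rfl
  · exact mul_le_mul_of_nonneg_left (hi j) (h.offDiag_nonneg i j hij)

/-- The minimum principle for `θ I - S`. -/
lemma IsPhaseType.nonneg_of_resolvent_nonneg (h : IsPhaseType α S) {θ : ℝ} (hθ : 0 < θ)
    {x : Fin n → ℝ} (hx : ∀ i, 0 ≤ θ * x i - (S *ᵥ x) i) (j : Fin n) : 0 ≤ x j := by
  obtain ⟨i, -, hi⟩ := Finset.exists_min_image Finset.univ x ⟨j, Finset.mem_univ j⟩
  have hmin := h.mulVec_ge_of_min fun j => hi j (Finset.mem_univ j)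
  by_contra! hj
  have hneg : x i < 0 := (hi j (Finset.mem_univ j)).trans_lt hj
  nlinarith [hx i, h.exit_nonneg i]

lemma resolvent_mulVec (S : Matrix (Fin n) (Fin n) ℝ) (θ : ℝ) (x : Fin n → ℝ) (i : Fin n) :
    ((θ • (1 : Matrix (Fin n) (Fin n) ℝ) - S) *ᵥ x) i = θ * x i - (S *ᵥ x) i := by
  simp [Matrix.sub_mulVec, Matrix.smul_mulVec]

lemma IsPhaseType.isUnit_resolvent (h : IsPhaseType α S) {θ : ℝ} (hθ : 0 < θ) :
    IsUnit (θ • (1 : Matrix (Fin n) (Fin n) ℝ) - S) := by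
  rw [← Matrix.mulVec_injective_iff_isUnit]
  intro x z hxz
  have key : ∀ i, θ * x i - (S *ᵥ x) i = θ * z i - (S *ᵥ z) i := fun i => by
    rw [← resolvent_mulVec, ← resolvent_mulVec]; exact congrFun hxz i
  funext i
  have h1 := h.nonneg_of_resolvent_nonneg hθ (x := x - z)
    (fun i => by simp only [Matrix.mulVec_sub, Pi.sub_apply]; linarith [key i]) i
  have h2 := h.nonneg_of_resolvent_nonneg hθ (x := z - x)
    (fun i => by simp only [Matrix.mulVec_sub, Pi.sub_apply]; linarith [key i]) i
  simp only [Pi.sub_apply] at h1 h2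
  linarith

/-- For each service phase, the probability that the job finishes before an exponential timer
with rate `θ` expires. -/
def phaseFinishProb (S : Matrix (Fin n) (Fin n) ℝ) (θ : ℝ) : Fin n → ℝ :=
  (θ • (1 : Matrix (Fin n) (Fin n) ℝ) - S)⁻¹ *ᵥ exitRate S

lemma finishProb_eq (α : Fin n → ℝ) (S : Matrix (Fin n) (Fin n) ℝ) (θ : ℝ) :
    α ⬝ᵥ phaseFinishProb S θ = finishProb α S θ := rfl

lemma IsPhaseType.mulVec_phaseFinishProb (h : IsPhaseType α S) {θ : ℝ} (hθ : 0 < θ) (i : Fin n) :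
    (S *ᵥ phaseFinishProb S θ) i = θ * phaseFinishProb S θ i - exitRate S i := by
  have hdet := (Matrix.isUnit_iff_isUnit_det _).1 (h.isUnit_resolvent hθ)
  have key := resolvent_mulVec S θ (phaseFinishProb S θ) i
  rw [phaseFinishProb, Matrix.mulVec_mulVec, Matrix.mul_nonsing_inv _ hdet,
    Matrix.one_mulVec] at key
  rw [phaseFinishProb]
  linarith

lemma IsPhaseType.phaseFinishProb_nonneg (h : IsPhaseType α S) {θ : ℝ} (hθ : 0 < θ) (i : Fin n) :
    0 ≤ phaseFinishProb S θ i :=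
  h.nonneg_of_resolvent_nonneg hθ (fun i => by
    rw [h.mulVec_phaseFinishProb hθ]; linarith [h.exit_nonneg i]) i

lemma IsPhaseType.phaseFinishProb_lt_one (h : IsPhaseType α S) {θ : ℝ} (hθ : 0 < θ) (j : Fin n) :
    phaseFinishProb S θ j < 1 := by
  obtain ⟨i, -, hi⟩ := Finset.exists_min_image Finset.univ (-phaseFinishProb S θ)
    ⟨j, Finset.mem_univ j⟩
  have hmin := h.mulVec_ge_of_min fun j => hi j (Finset.mem_univ j)
  have hj := hi j (Finset.mem_univ j)
  simp only [Matrix.mulVec_neg, Pi.neg_apply, h.mulVec_phaseFinishProb hθ] at hmin hj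
  by_contra! hge
  have h1 : 1 ≤ phaseFinishProb S θ i := by linarith
  nlinarith [h.exit_nonneg i]

/-- A job finishes early with positive probability from every phase: the phases from which it
could not would form a closed class without exits, and `S` would be singular on that class. -/
lemma IsPhaseType.phaseFinishProb_pos (h : IsPhaseType α S) {θ : ℝ} (hθ : 0 < θ) (j : Fin n) :
    0 < phaseFinishProb S θ j := by
  set v := phaseFinishProb S θ with hv
  refine lt_of_le_of_ne (h.phaseFinishProb_nonneg hθ j) fun hj0 => ?_
  let Z : Finset (Fin n) := Finset.univ.filter fun i => v i = 0
  -- `u` solves `S u = 1`, which fails at a maximum of `u` on the class `Z`.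
  let u : Fin n → ℝ := S⁻¹ *ᵥ 1
  have hu : S *ᵥ u = 1 := by
    rw [Matrix.mulVec_mulVec, Matrix.mul_nonsing_inv _ h.isUnit_det, Matrix.one_mulVec]
  obtain ⟨i, hiZ, hi⟩ := Finset.exists_max_image Z u ⟨j, by simp [Z, ← hj0]⟩
  have hvi : v i = 0 := by simpa [Z] using hiZ
  have hterm : ∀ k, 0 ≤ S i k * v k := fun k => by
    rcases eq_or_ne i k with rfl | hik
    · simp [hvi]
    · exact mul_nonneg (h.offDiag_nonneg i k hik) (h.phaseFinishProb_nonneg hθ k)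
  have hsum : ∑ k, S i k * v k = -exitRate S i := by
    have := h.mulVec_phaseFinishProb hθ i
    rw [← hv, hvi, mul_zero, zero_sub] at this
    exact this
  have hsum0 : ∑ k, S i k * v k = 0 :=
    le_antisymm (by linarith [h.exit_nonneg i]) (Finset.sum_nonneg fun k _ => hterm k)
  have hzero := (Finset.sum_eq_zero_iff_of_nonneg fun k (_ : k ∈ Finset.univ) => hterm k).1 hsum0
  have hle : (S *ᵥ u) i ≤ ∑ k, S i k * u i := by
    simp only [Matrix.mulVec, dotProduct]
    refine Finset.sum_le_sum fun k hk => ?_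
    rcases mul_eq_zero.1 (hzero k hk) with hS | hvk
    · simp [hS]
    · rcases eq_or_ne i k with rfl | hik
      · exact le_rfl
      · exact mul_le_mul_of_nonneg_left (hi k (by simp [Z, hvk])) (h.offDiag_nonneg i k hik)
  rw [hu, ← Finset.sum_mul] at hle
  have hrow := exitRate_apply S i
  have : ∑ k, S i k = 0 := by linarith
  rw [this] at hle
  norm_num at hle

lemma IsPhaseType.exists_alpha_pos (h : IsPhaseType α S) : ∃ j, 0 < α j := by
  by_contra! hle
  have : ∑ j, α j ≤ 0 := Finset.sum_nonpos fun j _ => hle j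
  linarith [h.alpha_sum]

lemma IsPhaseType.dotProduct_pos (h : IsPhaseType α S) {x : Fin n → ℝ} (hx : ∀ j, 0 < x j) :
    0 < α ⬝ᵥ x := by
  obtain ⟨j, hj⟩ := h.exists_alpha_pos
  exact Finset.sum_pos' (fun i _ => mul_nonneg (h.alpha_nonneg i) (hx i).le)
    ⟨j, Finset.mem_univ j, mul_pos hj (hx j)⟩

lemma IsPhaseType.dotProduct_const (h : IsPhaseType α S) (c : ℝ) : α ⬝ᵥ (fun _ => c) = c := by
  simp [dotProduct, ← Finset.sum_mul, h.alpha_sum]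

lemma IsPhaseType.finishProb_pos (h : IsPhaseType α S) {θ : ℝ} (hθ : 0 < θ) :
    0 < finishProb α S θ :=
  h.dotProduct_pos (h.phaseFinishProb_pos hθ)

lemma IsPhaseType.finishProb_lt_one (h : IsPhaseType α S) {θ : ℝ} (hθ : 0 < θ) :
    finishProb α S θ < 1 := by
  have := h.dotProduct_pos (x := (fun _ => 1) - phaseFinishProb S θ)
    fun j => sub_pos.2 (h.phaseFinishProb_lt_one hθ j)
  rw [dotProduct_sub, h.dotProduct_const, finishProb_eq] at this
  linarith

/-! ### The action of the generator on test functions -/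

/-- The states with a nonempty queue: `⟨k, i, j⟩` has estimated length `m + k`, actual length
`i + 1` and service phase `j`. -/
abbrev BusyState (m n : ℕ) : Type := Σ k : Fin 2, Fin (m + k) × Fin n

/-- The function on states with value `f₀ k` at the empty queue and `f k q j` at actual queue
length `q ≥ 1` and phase `j`, for estimated queue length `m + k`. -/
def testFun {m n : ℕ} (f₀ : Fin 2 → ℝ) (f : Fin 2 → ℕ → Fin n → ℝ) : State m n → ℝ
  | Sum.inl k => f₀ k
  | Sum.inr ⟨k, i, j⟩ => f k (i + 1) j

/-- The mean of a test function at estimated queue length `m + k` and actual queue length `q`, when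
the job in service, if any, starts now. -/
def freshMean (α : Fin n → ℝ) (f₀ : Fin 2 → ℝ) (f : Fin 2 → ℕ → Fin n → ℝ) (k : Fin 2)
    (q : ℕ) : ℝ :=
  if q = 0 then f₀ k else α ⬝ᵥ f k q

lemma sum_busyState_ite {m : ℕ} (k : Fin 2) {q : ℕ} (hq : 1 ≤ q) (hqk : q ≤ m + k)
    (H : Fin 2 → ℕ → Fin n → ℝ) :
    ∑ t : BusyState m n, (if (t.2.1 : ℕ) + 1 = q ∧ m + (t.1 : ℕ) = m + k then
      H t.1 (t.2.1 + 1) t.2.2 else 0) = ∑ j, H k q j := by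
  obtain ⟨i, rfl⟩ : ∃ i, q = i + 1 := ⟨q - 1, by omega⟩
  rw [Fintype.sum_sigma, Fintype.sum_eq_single k, Fintype.sum_prod_type,
    Fintype.sum_eq_single ⟨i, by omega⟩]
  · simp
  · rintro x hx
    refine Finset.sum_eq_zero fun j _ => if_neg ?_
    rintro ⟨h, -⟩
    exact hx (Fin.ext (by simpa using h))
  · rintro k' hk'
    refine Finset.sum_eq_zero fun t _ => if_neg ?_
    rintro ⟨-, h⟩
    exact hk' (Fin.ext (by simpa using h))

lemma rate_inl_inl (α : Fin n → ℝ) (S : Matrix (Fin n) (Fin n) ℝ) (δ : ℝ) (m : ℕ) (ν : ℝ)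
    (k k' : Fin 2) : rate α S δ m ν (Sum.inl k) (Sum.inl k') =
      if 0 = m ∧ m + (k' : ℕ) = m then δ else 0 := rfl

lemma rate_inl_inr (α : Fin n → ℝ) (S : Matrix (Fin n) (Fin n) ℝ) (δ : ℝ) (m : ℕ) (ν : ℝ)
    (k : Fin 2) (t : BusyState m n) : rate α S δ m ν (Sum.inl k) (Sum.inr t) =
      (if (t.2.1 : ℕ) + 1 = m ∧ m + (t.1 : ℕ) = m then δ * α t.2.2 else 0)
      + (if m + (k : ℕ) = m ∧ (t.2.1 : ℕ) + 1 = 1 ∧ m + (t.1 : ℕ) = m + 1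
          then ν * α t.2.2 else 0) := rfl

lemma rate_inr_inl (α : Fin n → ℝ) (S : Matrix (Fin n) (Fin n) ℝ) (δ : ℝ) (m : ℕ) (ν : ℝ)
    (s : BusyState m n) (k : Fin 2) : rate α S δ m ν (Sum.inr s) (Sum.inl k) =
      if (s.2.1 : ℕ) + 1 = 1 ∧ m + (k : ℕ) = m + s.1 then exitRate S s.2.2 else 0 := rfl

lemma rate_inr_inr (α : Fin n → ℝ) (S : Matrix (Fin n) (Fin n) ℝ) (δ : ℝ) (m : ℕ) (ν : ℝ)
    (s t : BusyState m n) : rate α S δ m ν (Sum.inr s) (Sum.inr t) =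
      (if s.2.2 ≠ t.2.2 ∧ (t.2.1 : ℕ) + 1 = s.2.1 + 1 ∧ m + (t.1 : ℕ) = m + s.1
        then S s.2.2 t.2.2 else 0)
      + (if (s.2.1 : ℕ) + 1 = t.2.1 + 1 + 1 ∧ m + (t.1 : ℕ) = m + s.1
        then exitRate S s.2.2 * α t.2.2 else 0)
      + (if t.2.2 = s.2.2 ∧ (t.2.1 : ℕ) + 1 = max ((s.2.1 : ℕ) + 1) m
          ∧ m + (t.1 : ℕ) = max ((s.2.1 : ℕ) + 1) m then δ else 0)
      + (if t.2.2 = s.2.2 ∧ m + (s.1 : ℕ) = m ∧ (t.2.1 : ℕ) + 1 = s.2.1 + 1 + 1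
          ∧ m + (t.1 : ℕ) = m + 1 then ν else 0) := rfl

lemma sum_rate_inl (α : Fin n → ℝ) (S : Matrix (Fin n) (Fin n) ℝ) (δ : ℝ) (m : ℕ) (ν : ℝ)
    (f₀ : Fin 2 → ℝ) (f : Fin 2 → ℕ → Fin n → ℝ) (k : Fin 2) :
    ∑ t, rate α S δ m ν (Sum.inl k) t * testFun f₀ f t =
      δ * freshMean α f₀ f 0 m + if k = 0 then ν * freshMean α f₀ f 1 1 else 0 := by
  have hprobe : ∑ k' : Fin 2, (if 0 = m ∧ m + (k' : ℕ) = m then δ else 0) * f₀ k' +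
      ∑ t : BusyState m n, (if (t.2.1 : ℕ) + 1 = m ∧ m + (t.1 : ℕ) = m then δ * α t.2.2 else 0) *
        f t.1 (t.2.1 + 1) t.2.2 = δ * freshMean α f₀ f 0 m := by
    rcases Nat.eq_zero_or_pos m with rfl | hm
    · simp [freshMean]
    · have h := sum_busyState_ite (n := n) (m := m) 0 hm (by simp)
        (fun k q j => δ * α j * f k q j)
      simp only [ite_mul, zero_mul, hm.ne, false_and, if_false, Finset.sum_const_zero, zero_add]
      simp only [Fin.val_zero, add_zero] at h
      rw [h]
      simp [freshMean, hm.ne', dotProduct, Finset.mul_sum, mul_assoc]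
  have hassign : ∑ t : BusyState m n, (if m + (k : ℕ) = m ∧ (t.2.1 : ℕ) + 1 = 1 ∧
      m + (t.1 : ℕ) = m + 1 then ν * α t.2.2 else 0) * f t.1 (t.2.1 + 1) t.2.2 =
      if k = 0 then ν * freshMean α f₀ f 1 1 else 0 := by
    have h := sum_busyState_ite (n := n) (m := m) 1 (le_refl 1) (by simp)
      (fun k q j => ν * α j * f k q j)
    by_cases hk : k = 0
    · subst hk
      simp only [ite_mul, zero_mul, Fin.val_zero, add_zero, true_and, if_true]
      simp only [Fin.val_one] at h
      rw [h]
      simp [freshMean, dotProduct, Finset.mul_sum, mul_assoc]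
    · simp [hk]
  rw [Fintype.sum_sum_type, ← hprobe, ← hassign]
  simp only [rate_inl_inl, rate_inl_inr, testFun, add_mul, Finset.sum_add_distrib]
  ring

lemma sum_rate_inr (α : Fin n → ℝ) (S : Matrix (Fin n) (Fin n) ℝ) (δ : ℝ) (m : ℕ) (ν : ℝ)
    (f₀ : Fin 2 → ℝ) (f : Fin 2 → ℕ → Fin n → ℝ) (s : BusyState m n) :
    ∑ t, rate α S δ m ν (Sum.inr s) t * testFun f₀ f t =
      ∑ j, (if s.2.2 ≠ j then S s.2.2 j else 0) * f s.1 (s.2.1 + 1) j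
      + exitRate S s.2.2 * freshMean α f₀ f s.1 s.2.1
      + δ * (if (s.2.1 : ℕ) + 1 ≤ m then f 0 m s.2.2 else f s.1 (s.2.1 + 1) s.2.2)
      + if s.1 = 0 then ν * f 1 (s.2.1 + 2) s.2.2 else 0 := by
  obtain ⟨k, i, j⟩ := s
  have hi := i.isLt
  have hphase : ∑ t : BusyState m n, (if j ≠ t.2.2 ∧ (t.2.1 : ℕ) + 1 = i + 1 ∧
      m + (t.1 : ℕ) = m + k then S j t.2.2 else 0) * f t.1 (t.2.1 + 1) t.2.2 =
      ∑ j', (if j ≠ j' then S j j' else 0) * f k (i + 1) j' := by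
    rw [← sum_busyState_ite (n := n) (m := m) k (q := i + 1) (by omega) (by omega)
      (fun k q j' => (if j ≠ j' then S j j' else 0) * f k q j')]
    refine Finset.sum_congr rfl fun t _ => ?_
    by_cases h1 : j ≠ t.2.2 <;> simp [h1]
  have hserve : ∑ k' : Fin 2, (if (i : ℕ) + 1 = 1 ∧ m + (k' : ℕ) = m + k then exitRate S j else 0)
        * f₀ k' +
      ∑ t : BusyState m n, (if (i : ℕ) + 1 = t.2.1 + 1 + 1 ∧ m + (t.1 : ℕ) = m + k then
        exitRate S j * α t.2.2 else 0) * f t.1 (t.2.1 + 1) t.2.2 =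
      exitRate S j * freshMean α f₀ f k i := by
    rcases Nat.eq_zero_or_pos (i : ℕ) with h0 | hpos
    · simp only [h0, freshMean, if_true]
      rw [Fintype.sum_eq_single k]
      · simp
      · intro k' hk'
        have : ¬ (k' : ℕ) = k := fun h => hk' (Fin.ext h)
        simp [this]
    · have h := sum_busyState_ite (n := n) (m := m) k (q := i) hpos (by omega)
        (fun k q j' => exitRate S j * α j' * f k q j')
      have hne : ¬ ((i : ℕ) + 1 = 1) := by omega
      simp only [ite_mul, zero_mul, hne, false_and, if_false, Finset.sum_const_zero, zero_add]
      simp only [add_left_inj, eq_comm (a := (i : ℕ))]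
      rw [h]
      simp [freshMean, hpos.ne', dotProduct, Finset.mul_sum, mul_assoc]
  have hprobe : ∑ t : BusyState m n, (if t.2.2 = j ∧ (t.2.1 : ℕ) + 1 = max ((i : ℕ) + 1) m ∧
      m + (t.1 : ℕ) = max ((i : ℕ) + 1) m then δ else 0) * f t.1 (t.2.1 + 1) t.2.2 =
      δ * (if (i : ℕ) + 1 ≤ m then f 0 m j else f k (i + 1) j) := by
    by_cases him : (i : ℕ) + 1 ≤ m
    · have h := sum_busyState_ite (n := n) (m := m) 0 (q := m) (by omega) (by simp)
        (fun k q j' => if j' = j then δ * f k q j' else 0)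
      rw [if_pos him, max_eq_right him]
      simp only [Finset.sum_ite_eq', Finset.mem_univ, if_true, Fin.val_zero, add_zero] at h
      rw [← h]
      refine Finset.sum_congr rfl fun t _ => ?_
      by_cases h1 : t.2.2 = j <;> simp [h1]
    · -- the queue is longer than `m`, so that `k = 1` and the probe does not change the state
      have hk : (i : ℕ) + 1 = m + k := by omega
      have h := sum_busyState_ite (n := n) (m := m) k (q := i + 1) (by omega) (by omega)
        (fun k q j' => if j' = j then δ * f k q j' else 0)
      rw [if_neg him, max_eq_left (by omega)]
      simp only [Finset.sum_ite_eq', Finset.mem_univ, if_true] at h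
      rw [← h]
      refine Finset.sum_congr rfl fun t _ => ?_
      by_cases h1 : t.2.2 = j <;> simp [h1, hk]
  have hassign : ∑ t : BusyState m n, (if t.2.2 = j ∧ m + (k : ℕ) = m ∧
      (t.2.1 : ℕ) + 1 = i + 1 + 1 ∧ m + (t.1 : ℕ) = m + 1 then ν else 0) *
      f t.1 (t.2.1 + 1) t.2.2 = if k = 0 then ν * f 1 (i + 2) j else 0 := by
    by_cases hk : k = 0
    · subst hk
      simp only [Fin.val_zero, add_zero] at hi
      have h := sum_busyState_ite (n := n) (m := m) 1 (q := i + 2) (by omega)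
        (by simp only [Fin.val_one]; omega)
        (fun k q j' => if j' = j then ν * f k q j' else 0)
      simp only [Finset.sum_ite_eq', Finset.mem_univ, if_true, Fin.val_one] at h
      rw [if_pos rfl, ← h]
      refine Finset.sum_congr rfl fun t _ => ?_
      by_cases h1 : t.2.2 = j <;> simp [h1]
    · simp [hk]
  rw [Fintype.sum_sum_type, ← hphase, ← hserve, ← hprobe, ← hassign]
  simp only [rate_inr_inl, rate_inr_inr, testFun, add_mul, Finset.sum_add_distrib]
  ring

lemma generator_mulVec (α : Fin n → ℝ) (S : Matrix (Fin n) (Fin n) ℝ) (δ : ℝ) (m : ℕ) (ν : ℝ)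
    (T : State m n → ℝ) (s : State m n) :
    (generator α S δ m ν *ᵥ T) s =
      ∑ t, rate α S δ m ν s t * T t - (∑ t, rate α S δ m ν s t * 1) * T s := by
  rw [generator, Matrix.sub_mulVec, Pi.sub_apply, Matrix.mulVec_diagonal]
  simp [Matrix.mulVec, dotProduct]

lemma testFun_one {m n : ℕ} (s : State m n) :
    testFun (fun _ => 1) (fun _ _ _ => 1) s = 1 := by
  rcases s with k | ⟨k, i, j⟩ <;> rfl

lemma IsPhaseType.freshMean_one (h : IsPhaseType α S) (k : Fin 2) (q : ℕ) :
    freshMean α (fun _ => 1) (fun _ _ _ => 1) k q = 1 := by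
  simp [freshMean, h.dotProduct_const]

/-- The drift of a test function at an empty queue. -/
lemma IsPhaseType.generator_mulVec_inl (h : IsPhaseType α S) (δ : ℝ) (m : ℕ) (ν : ℝ)
    (f₀ : Fin 2 → ℝ) (f : Fin 2 → ℕ → Fin n → ℝ) (k : Fin 2) :
    (generator α S δ m ν *ᵥ testFun f₀ f) (Sum.inl k) =
      δ * (freshMean α f₀ f 0 m - f₀ k)
      + if k = 0 then ν * (freshMean α f₀ f 1 1 - f₀ k) else 0 := by
  have hone := sum_rate_inl α S δ m ν (fun _ => 1) (fun _ _ _ => 1) k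
  simp only [testFun_one, h.freshMean_one] at hone
  rw [generator_mulVec, sum_rate_inl, hone, testFun]
  split_ifs <;> ring

/-- The drift of a test function at a nonempty queue: phase changes and service completions together
contribute the first two terms, since the rows of `S` sum to `-exitRate S`. -/
lemma IsPhaseType.generator_mulVec_inr (h : IsPhaseType α S) (δ : ℝ) (m : ℕ) (ν : ℝ)
    (f₀ : Fin 2 → ℝ) (f : Fin 2 → ℕ → Fin n → ℝ) (s : BusyState m n) :
    (generator α S δ m ν *ᵥ testFun f₀ f) (Sum.inr s) =
      (S *ᵥ f s.1 (s.2.1 + 1)) s.2.2 + exitRate S s.2.2 * freshMean α f₀ f s.1 s.2.1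
      + δ * ((if (s.2.1 : ℕ) + 1 ≤ m then f 0 m s.2.2 else f s.1 (s.2.1 + 1) s.2.2)
          - f s.1 (s.2.1 + 1) s.2.2)
      + if s.1 = 0 then ν * (f 1 (s.2.1 + 2) s.2.2 - f s.1 (s.2.1 + 1) s.2.2) else 0 := by
  have hone := sum_rate_inr α S δ m ν (fun _ => 1) (fun _ _ _ => 1) s
  simp only [testFun_one, h.freshMean_one, ite_self] at hone
  rw [generator_mulVec, sum_rate_inr, hone]
  have hrow : ∀ x : Fin n → ℝ, ∑ j, (if s.2.2 ≠ j then S s.2.2 j else 0) * x j =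
      (S *ᵥ x) s.2.2 - S s.2.2 s.2.2 * x s.2.2 := fun x => by
    rw [eq_sub_iff_add_eq, Matrix.mulVec, dotProduct,
      ← Finset.add_sum_erase _ _ (Finset.mem_univ s.2.2),
      ← Finset.add_sum_erase (a := s.2.2) (s := Finset.univ) (f := fun j => S s.2.2 j * x j)
        (h := Finset.mem_univ _)]
    simp only [ne_eq, not_true_eq_false, if_false, zero_mul, zero_add]
    rw [add_comm]
    congr 1
    refine Finset.sum_congr rfl fun j hj => ?_
    rw [if_pos (Finset.ne_of_mem_erase hj).symm]
  have h1 := hrow fun _ => 1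
  have hS : (S *ᵥ fun _ => 1) s.2.2 = -exitRate S s.2.2 := by
    simp [exitRate_apply, Matrix.mulVec, dotProduct]
  rw [hrow, h1, hS]
  obtain ⟨k, i, j⟩ := s
  simp only [testFun]
  split_ifs <;> ring

/-- Under a stationary law, the mean drift of a test function is zero. -/
lemma IsStationary.sum_drift_eq_zero {δ ν : ℝ} {m : ℕ} {p : State m n → ℝ}
    (hp : IsStationary (generator α S δ m ν) p) (T : State m n → ℝ) :
    ∑ k, p (Sum.inl k) * (generator α S δ m ν *ᵥ T) (Sum.inl k)
      + ∑ s : BusyState m n, p (Sum.inr s) * (generator α S δ m ν *ᵥ T) (Sum.inr s) = 0 := by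
  have h : p ⬝ᵥ (generator α S δ m ν *ᵥ T) = 0 := by
    rw [Matrix.dotProduct_mulVec, hp.balance, zero_dotProduct]
  rwa [dotProduct, Fintype.sum_sum_type] at h

/-! ### Balance identities of the stationary law -/

variable {δ ν : ℝ} {m : ℕ} {p : State m n → ℝ}

lemma mulVec_const (S : Matrix (Fin n) (Fin n) ℝ) (c : ℝ) (j : Fin n) :
    (S *ᵥ fun _ => c) j = -exitRate S j * c := by
  simp [exitRate_apply, Matrix.mulVec, dotProduct, Finset.sum_mul]

/-- The balance identity of the test function `testFun f₀ f` with drift `d₀ k` at an empty queue and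
`d k i j` at actual queue length `i + 1` and phase `j`, for estimated queue length `m + k`. -/
lemma IsStationary.sum_eq_zero_of_drift (hp : IsStationary (generator α S δ m ν) p)
    (h : IsPhaseType α S) (f₀ : Fin 2 → ℝ) (f : Fin 2 → ℕ → Fin n → ℝ) (d₀ : Fin 2 → ℝ)
    (d : (k : Fin 2) → ℕ → Fin n → ℝ)
    (h₀ : ∀ k : Fin 2, δ * (freshMean α f₀ f 0 m - f₀ k)
      + (if k = 0 then ν * (freshMean α f₀ f 1 1 - f₀ k) else 0) = d₀ k)
    (h₁ : ∀ (k : Fin 2) (i : ℕ) (j : Fin n), i < m + k →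
      (S *ᵥ f k (i + 1)) j + exitRate S j * freshMean α f₀ f k i
      + δ * ((if i + 1 ≤ m then f 0 m j else f k (i + 1) j) - f k (i + 1) j)
      + (if k = 0 then ν * (f 1 (i + 2) j - f k (i + 1) j) else 0) = d k i j) :
    p (Sum.inl 0) * d₀ 0 + p (Sum.inl 1) * d₀ 1
      + ∑ s : BusyState m n, p (Sum.inr s) * d s.1 s.2.1 s.2.2 = 0 := by
  have key := hp.sum_drift_eq_zero (testFun f₀ f)
  simp only [h.generator_mulVec_inl, h.generator_mulVec_inr, h₀] at key
  rw [Fin.sum_univ_two] at key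
  rw [← key]
  congr 1
  exact Finset.sum_congr rfl fun s _ => by rw [h₁ _ _ _ s.2.1.isLt]

/-- The balance identity for a function of the service phase alone, centred so that a job that
starts service contributes zero. -/
lemma IsStationary.sum_phase (hp : IsStationary (generator α S δ m ν) p) (h : IsPhaseType α S)
    (g : Fin n → ℝ) :
    ∑ s : BusyState m n, p (Sum.inr s) *
      ((S *ᵥ g) s.2.2 + exitRate S s.2.2 * (α ⬝ᵥ g)) = 0 := by
  have hfresh : ∀ k q, freshMean α (fun _ => 0) (fun _ _ => g - fun _ => α ⬝ᵥ g) k q = 0 :=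
    fun k q => by simp [freshMean, h.dotProduct_const]
  have := hp.sum_eq_zero_of_drift h (fun _ => 0) (fun _ _ => g - fun _ => α ⬝ᵥ g) (fun _ => 0)
    (fun _ _ j => (S *ᵥ g) j + exitRate S j * (α ⬝ᵥ g))
    (fun k => by simp only [hfresh]; split_ifs <;> ring)
    (fun k i j _ => by
      simp only [hfresh, Matrix.mulVec_sub, Pi.sub_apply, mulVec_const]
      split_ifs <;> ring)
  simpa using this

/-- With mean service time one, the rate of service completions is the probability of a nonempty
queue. -/
lemma IsStationary.sum_exitRate (hp : IsStationary (generator α S δ m ν) p)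
    (h : IsPhaseType α S) (hmean : phMean α S = 1) :
    ∑ s : BusyState m n, p (Sum.inr s) * exitRate S s.2.2 =
      ∑ s : BusyState m n, p (Sum.inr s) := by
  have hdet : IsUnit (-S).det := by
    rw [← Matrix.isUnit_iff_isUnit_det, IsUnit.neg_iff, Matrix.isUnit_iff_isUnit_det]
    exact h.isUnit_det
  have hS : S *ᵥ ((-S)⁻¹ *ᵥ 1) = -1 := by
    rw [← neg_inj, ← Matrix.neg_mulVec, Matrix.mulVec_mulVec, Matrix.mul_nonsing_inv _ hdet,
      Matrix.one_mulVec, neg_neg]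
  have key := hp.sum_phase h ((-S)⁻¹ *ᵥ 1)
  rw [← phMean, hmean, hS] at key
  simp only [Pi.neg_apply, Pi.one_apply, mul_add, Finset.sum_add_distrib, mul_neg, mul_one,
    Finset.sum_neg_distrib] at key
  linarith

/-- The mean of `phaseFinishProb S δ` over the nonempty queue: the service phase has the equilibrium
law of the service renewal process, whatever the arrivals and probes. -/
lemma IsStationary.sum_phaseFinishProb (hp : IsStationary (generator α S δ m ν) p)
    (h : IsPhaseType α S) (hmean : phMean α S = 1) (hδ : 0 < δ) :
    δ * ∑ s : BusyState m n, p (Sum.inr s) * phaseFinishProb S δ s.2.2 =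
      (1 - finishProb α S δ) * ∑ s : BusyState m n, p (Sum.inr s) := by
  have key := hp.sum_phase h (phaseFinishProb S δ)
  rw [← hp.sum_exitRate h hmean, finishProb_eq] at *
  rw [← sub_eq_zero, ← key, Finset.mul_sum, Finset.mul_sum, ← Finset.sum_sub_distrib]
  refine Finset.sum_congr rfl fun s _ => ?_
  rw [h.mulVec_phaseFinishProb hδ]
  ring

/-- The balance identity for the difference between the actual and the estimated queue length: an
assignment keeps it, a probe resets it to zero, and a service completion lowers it by one. -/
lemma IsStationary.sum_est_sub_queue (hp : IsStationary (generator α S δ m ν) p)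
    (h : IsPhaseType α S) :
    δ * (p (Sum.inl 0) * m + p (Sum.inl 1) * (m + 1)
      + ∑ s : BusyState m n, p (Sum.inr s) * (m + (s.1 : ℕ) - (s.2.1 + 1))) =
      ∑ s : BusyState m n, p (Sum.inr s) * exitRate S s.2.2 := by
  have hfresh : ∀ (k : Fin 2) (q : ℕ), freshMean α (fun k => -((m : ℝ) + (k : ℕ)))
      (fun k q _ => (q : ℝ) - (m + (k : ℕ))) k q = (q : ℝ) - (m + (k : ℕ)) := fun k q => by
    rw [freshMean, h.dotProduct_const]
    split_ifs with hq <;> simp [hq]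
  have key := hp.sum_eq_zero_of_drift h (fun k => -((m : ℝ) + (k : ℕ)))
    (fun k q _ => (q : ℝ) - (m + (k : ℕ))) (fun k => δ * (m + (k : ℕ)))
    (fun k i j => δ * (m + (k : ℕ) - (i + 1)) - exitRate S j)
    (fun k => by
      simp only [hfresh]
      split_ifs with hk
      · subst hk; push_cast [Fin.val_zero, Fin.val_one]; ring
      · push_cast [Fin.val_zero]; ring)
    (fun k i j hi => by
      simp only [hfresh, mulVec_const]
      have hprobe : ¬ (i + 1 ≤ m) → (i : ℝ) + 1 = m + (k : ℕ) := fun him => by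
        have : i + 1 = m + (k : ℕ) := by omega
        exact_mod_cast this
      split_ifs with him hk hk
      · subst hk; push_cast [Fin.val_zero, Fin.val_one]; ring
      · push_cast [Fin.val_zero]; ring
      · subst hk; rw [Fin.val_zero] at hi; omega
      · push_cast; linear_combination δ * hprobe him)
  simp only [mul_sub, Finset.sum_sub_distrib] at key
  rw [← sub_eq_zero, ← key]
  simp only [mul_add, mul_sub, Finset.mul_sum, Finset.sum_add_distrib, Finset.sum_sub_distrib,
    Fin.val_zero, Fin.val_one, Nat.cast_zero, Nat.cast_one]
  simp only [mul_left_comm δ]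
  ring

/-- The balance identity for the probability that the queue empties before the next probe,
multiplied by `y` when the estimated length is `m`. The assignments, which carry the factor `y`
from one estimated length to the other, drop out. -/
lemma IsStationary.finishProb_balance (hp : IsStationary (generator α S δ m ν) p)
    (h : IsPhaseType α S) (hmean : phMean α S = 1) (hδ : 0 < δ) :
    finishProb α S δ * p (Sum.inl 0) + p (Sum.inl 1) =
      finishProb α S δ ^ (m + 1) * (p (Sum.inl 0) + p (Sum.inl 1))
      + finishProb α S δ ^ m * (1 - finishProb α S δ) / δ * ∑ s : BusyState m n, p (Sum.inr s) := by
  set y := finishProb α S δ with hy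
  set v := phaseFinishProb S δ with hv
  have hαv : α ⬝ᵥ v = y := rfl
  have hSv : ∀ j, (S *ᵥ v) j = δ * v j - exitRate S j := h.mulVec_phaseFinishProb hδ
  let w : Fin 2 → ℝ := fun k => if k = 0 then y else 1
  have hfresh : ∀ (k : Fin 2) (q : ℕ),
      freshMean α w (fun k q => (w k * y ^ (q - 1)) • v) k q = w k * y ^ q := fun k q => by
    rw [freshMean, dotProduct_smul, hαv]
    split_ifs with hq
    · simp [hq]
    · obtain ⟨q, rfl⟩ := Nat.exists_eq_succ_of_ne_zero hq
      simp only [Nat.succ_eq_add_one, Nat.add_sub_cancel, smul_eq_mul, pow_succ]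
      ring
  have key := hp.sum_eq_zero_of_drift h w (fun k q => (w k * y ^ (q - 1)) • v)
    (fun k => δ * (y ^ (m + 1) - w k)) (fun _ _ j => δ * (y ^ m * v j))
    (fun k => by
      simp only [hfresh]
      split_ifs with hk
      · subst hk; simp only [w, if_true, one_ne_zero, if_false]; ring
      · simp only [w, if_true]; ring)
    (fun k i j hi => by
      simp only [hfresh, Matrix.mulVec_smul, Pi.smul_apply, smul_eq_mul, Nat.add_sub_cancel, hSv]
      have hprobe : (if i + 1 ≤ m then w 0 * y ^ (m - 1) * v j
          else w k * y ^ i * v j) = y ^ m * v j := by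
        split_ifs with him
        · obtain ⟨m, rfl⟩ : ∃ m', m = m' + 1 := ⟨m - 1, by omega⟩
          simp only [w, if_true, Nat.add_sub_cancel, pow_succ]; ring
        · -- A queue longer than `m` has length `m + 1`.
          have hk : k = 1 := by
            by_contra hk
            have : k = 0 := by omega
            subst this; rw [Fin.val_zero] at hi; omega
          subst hk
          have : i = m := by rw [Fin.val_one] at hi; omega
          simp [w, this]
      rw [hprobe]
      split_ifs with hk
      · subst hk
        have : i + 2 - 1 = i + 1 := rfl
        simp only [w, if_true, one_ne_zero, if_false, this, pow_succ]; ring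
      · ring)
  have hphase := hp.sum_phaseFinishProb h hmean hδ
  have hsum : ∑ s : BusyState m n, p (Sum.inr s) * (δ * (y ^ m * v s.2.2)) =
      y ^ m * (δ * ∑ s : BusyState m n, p (Sum.inr s) * v s.2.2) := by
    rw [Finset.mul_sum, Finset.mul_sum]
    exact Finset.sum_congr rfl fun s _ => by ring
  simp only [hsum, w, if_true, one_ne_zero, if_false] at key
  rw [hphase] at key
  field_simp
  linear_combination -key

/-- The probability that the estimated queue length is `m + k`. -/
def estProb (p : State m n → ℝ) (k : Fin 2) : ℝ :=
  p (Sum.inl k) + ∑ x, p (Sum.inr ⟨k, x⟩)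

/-- At estimated length `m + 1` the queue empties only when a last job that started service afresh
finishes before a probe. The test function is the probability that this happens, given that the
last job has started service at estimated length `m + 1`, and its mean `y` in all earlier states. -/
lemma IsStationary.prob_empty_le_finishProb_mul (hp : IsStationary (generator α S δ m ν) p)
    (h : IsPhaseType α S) (hδ : 0 < δ) (hm : 1 ≤ m) :
    p (Sum.inl 1) ≤ finishProb α S δ * estProb p 1 := by
  set y := finishProb α S δ with hy
  set v := phaseFinishProb S δ with hv
  have hαv : α ⬝ᵥ v = y := rfl
  have hy0 : 0 < y := h.finishProb_pos hδ
  let f₀ : Fin 2 → ℝ := fun k => if k = 0 then y else 1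
  let f : Fin 2 → ℕ → Fin n → ℝ := fun k q => if k = 1 ∧ q = 1 then v else fun _ => y
  have hfresh : ∀ (k : Fin 2) (q : ℕ),
      freshMean α f₀ f k q = if k = 1 ∧ q = 0 then 1 else y := fun k q => by
    have h2 : α ⬝ᵥ f k q = y := by
      simp only [f]; split_ifs
      · exact hαv
      · exact h.dotProduct_const y
    rw [freshMean, h2]
    fin_cases k <;> simp [f₀]
  have key := hp.sum_eq_zero_of_drift h f₀ f (fun k => if k = 1 then δ * (y - 1) else 0)
    (fun k i _ => if k = 1 ∧ i = 0 then δ * y else 0)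
    (fun k => by
      simp only [hfresh, f₀]
      fin_cases k <;> simp)
    (fun k i j hi => by
      have hSf := mulVec_const S y j
      have hSv := h.mulVec_phaseFinishProb hδ j
      rw [← hv] at hSv
      rcases Nat.eq_zero_or_pos i with rfl | hpos
      · fin_cases k
        · simp [hfresh, f, hm, hSf]
        · simp [hfresh, f, hm, hSv]; ring
      · have hne : i ≠ 0 := hpos.ne'
        have : (f 0 m j) = y := by simp [f]
        fin_cases k <;> simp [hfresh, f, hSf, hne])
  have hsum : ∑ s : BusyState m n,
      p (Sum.inr s) * (if s.1 = 1 ∧ (s.2.1 : ℕ) = 0 then δ * y else 0) ≤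
        δ * y * ∑ x, p (Sum.inr ⟨1, x⟩) := by
    rw [Fintype.sum_sigma, Fin.sum_univ_two, Finset.mul_sum]
    simp only [zero_ne_one, false_and, if_false, mul_zero, Finset.sum_const_zero, zero_add,
      true_and]
    refine Finset.sum_le_sum fun x _ => ?_
    have := hp.nonneg (Sum.inr ⟨1, x⟩)
    split_ifs
    · exact (mul_comm _ _).le
    · rw [mul_zero]; positivity
  simp only [zero_ne_one, if_true, if_false, mul_zero, zero_add] at key
  have h1 : 0 ≤ δ * (y * ∑ x, p (Sum.inr ⟨1, x⟩) - p (Sum.inl 1) * (1 - y)) := by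
    linarith
  have h2 := (mul_nonneg_iff_of_pos_left hδ).1 h1
  rw [estProb]
  linarith

/-- From every state with estimated length `m + k` the queue can empty before a probe or an
assignment. The test function is the probability that this happens before a timer expires whose
rate exceeds their total rate `δ + ν`. -/
lemma IsStationary.estProb_eq_zero (hp : IsStationary (generator α S δ m ν) p)
    (h : IsPhaseType α S) (hδ : 0 < δ) (hν : 0 ≤ ν) {k : Fin 2} (hk : p (Sum.inl k) = 0) :
    estProb p k = 0 := by
  set θ := δ + ν + 1 with hθ
  have hθ0 : 0 < θ := by positivity
  set y := finishProb α S θ with hy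
  set v := phaseFinishProb S θ with hv
  have hαv : α ⬝ᵥ v = y := rfl
  have hy0 : 0 < y := h.finishProb_pos hθ0
  have hv0 : ∀ j, 0 < v j := h.phaseFinishProb_pos hθ0
  let w : Fin 2 → ℝ := fun k' => if k' = k then 1 else 0
  have hw : ∀ k', 0 ≤ w k' := fun k' => by simp only [w]; split_ifs <;> norm_num
  let f : Fin 2 → ℕ → Fin n → ℝ := fun k' q => (w k' * y ^ (q - 1)) • v
  have hf : ∀ k' q j, 0 ≤ f k' q j := fun k' q j =>
    mul_nonneg (mul_nonneg (hw k') (by positivity)) (hv0 j).le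
  have hfresh : ∀ (k' : Fin 2) (q : ℕ), freshMean α w f k' q = w k' * y ^ q := fun k' q => by
    rw [freshMean, dotProduct_smul, hαv]
    split_ifs with hq
    · simp [hq]
    · obtain ⟨q, rfl⟩ := Nat.exists_eq_succ_of_ne_zero hq
      simp only [Nat.succ_eq_add_one, Nat.add_sub_cancel, smul_eq_mul, pow_succ]
      ring
  have key := hp.sum_drift_eq_zero (testFun w f)
  have hempty : 0 ≤ ∑ k', p (Sum.inl k') *
      (generator α S δ m ν *ᵥ testFun w f) (Sum.inl k') := by
    refine Finset.sum_nonneg fun k' _ => ?_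
    rcases eq_or_ne k' k with rfl | hne
    · simp [hk]
    · refine mul_nonneg (hp.nonneg _) ?_
      have hwk : w k' = 0 := if_neg hne
      have h1 : ∀ k' q, 0 ≤ w k' * y ^ q := fun k' q => mul_nonneg (hw k') (by positivity)
      have h2 := h1 0 m
      have h3 := h1 1 1
      rw [h.generator_mulVec_inl, hfresh, hfresh, hwk, sub_zero, sub_zero]
      split_ifs <;> positivity
  -- Probes and assignments cancel at most `δ + ν` of the growth rate `δ + ν + 1` of `f`.
  have hbusy : ∀ s : BusyState m n, f s.1 (s.2.1 + 1) s.2.2 ≤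
      (generator α S δ m ν *ᵥ testFun w f) (Sum.inr s) := by
    rintro ⟨k', i, j⟩
    have hSf : (S *ᵥ f k' (i + 1)) j + exitRate S j * (w k' * y ^ (i : ℕ)) =
        θ * f k' (i + 1) j := by
      simp only [f, Matrix.mulVec_smul, Pi.smul_apply, smul_eq_mul, Nat.add_sub_cancel, hv,
        h.mulVec_phaseFinishProb hθ0]
      ring
    have h1 := hf k' (i + 1) j
    have h2 := mul_nonneg hδ.le (hf 0 m j)
    have h3 := mul_nonneg hν (hf 1 (i + 2) j)
    have h4 := mul_nonneg hν h1
    have h5 := mul_nonneg hδ.le h1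
    rw [h.generator_mulVec_inr, hfresh]
    simp only [hSf, hθ]
    split_ifs <;> linarith
  have hle : ∑ s : BusyState m n, p (Sum.inr s) * f s.1 (s.2.1 + 1) s.2.2 ≤ 0 := by
    refine le_trans (Finset.sum_le_sum fun s _ =>
      mul_le_mul_of_nonneg_left (hbusy s) (hp.nonneg _)) ?_
    linarith
  have hterm : ∀ s : BusyState m n, 0 ≤ p (Sum.inr s) * f s.1 (s.2.1 + 1) s.2.2 := fun s =>
    mul_nonneg (hp.nonneg _) (hf _ _ _)
  have hzero := (Finset.sum_eq_zero_iff_of_nonneg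
    fun s (_ : s ∈ Finset.univ) => hterm s).1
      (le_antisymm hle (Finset.sum_nonneg fun s _ => hterm s))
  rw [estProb, hk, zero_add]
  refine Finset.sum_eq_zero fun x _ => ?_
  have hpos : 0 < f k (x.1 + 1) x.2 := by
    have := hv0 x.2
    simp only [f, w, if_true, Pi.smul_apply, smul_eq_mul]
    positivity
  exact (mul_eq_zero.1 (hzero ⟨k, x⟩ (Finset.mem_univ _))).resolve_right hpos.ne'

/-! ### The mean queue length -/

lemma sum_busyState (F : BusyState m n → ℝ) :
    ∑ s, F s = ∑ x, F ⟨0, x⟩ + ∑ x, F ⟨1, x⟩ := by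
  rw [Fintype.sum_sigma, Fin.sum_univ_two]

lemma sum_state_eq (p : State m n → ℝ) : ∑ s, p s = estProb p 0 + estProb p 1 := by
  rw [Fintype.sum_sum_type, Fin.sum_univ_two, sum_busyState, estProb, estProb]
  ring

lemma queueProb_zero (p : State m n → ℝ) : queueProb p 0 = p (Sum.inl 0) + p (Sum.inl 1) := by
  rw [queueProb, Finset.sum_filter, Fintype.sum_sum_type, Fin.sum_univ_two]
  simp [State.queue]

lemma queue_lt (s : State m n) : State.queue s < m + 2 := by
  rcases s with k | ⟨k, i, j⟩
  · simp [State.queue]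
  · have := i.isLt
    simp only [State.queue]
    omega

lemma meanQueue_eq (p : State m n → ℝ) :
    meanQueue p = ∑ s : BusyState m n, p (Sum.inr s) * ((s.2.1 : ℝ) + 1) := by
  have h1 : meanQueue p = ∑ s, p s * (State.queue s : ℝ) := by
    rw [← Finset.sum_fiberwise_of_maps_to (g := State.queue) (t := Finset.range (m + 2))
      fun s _ => Finset.mem_range.2 (queue_lt s)]
    refine Finset.sum_congr rfl fun q _ => ?_
    rw [queueProb, Finset.mul_sum]
    refine Finset.sum_congr rfl fun s hs => ?_
    rw [(Finset.mem_filter.1 hs).2, mul_comm]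
  rw [h1, Fintype.sum_sum_type]
  simp [State.queue]

lemma IsCavityLaw.sum_busy {lam : ℝ} (hp : IsCavityLaw α S lam δ m ν p) :
    ∑ s : BusyState m n, p (Sum.inr s) = lam := by
  have h1 := hp.stationary.sum_eq_one
  have h2 := hp.prob_empty
  rw [Fintype.sum_sum_type, Fin.sum_univ_two] at h1
  rw [queueProb_zero] at h2
  linarith

/-- The mean queue length is the mean estimated queue length less `lam / δ`. -/
lemma IsCavityLaw.meanQueue_eq {lam : ℝ} (hp : IsCavityLaw α S lam δ m ν p) (h : IsPhaseType α S)
    (hmean : phMean α S = 1) (hδ : 0 < δ) :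
    meanQueue p = m - lam / δ + estProb p 1 := by
  have h1 := hp.stationary.sum_est_sub_queue h
  have h2 := hp.stationary.sum_eq_one
  rw [hp.stationary.sum_exitRate h hmean, hp.sum_busy] at h1
  have h3 : ∑ s : BusyState m n, p (Sum.inr s) * (m + ((s.1 : ℕ) : ℝ) - (s.2.1 + 1)) =
      m * ∑ x, p (Sum.inr ⟨0, x⟩) + (m + 1) * ∑ x, p (Sum.inr ⟨1, x⟩) - meanQueue p := by
    rw [PushCavity.meanQueue_eq]
    simp only [mul_sub, Finset.sum_sub_distrib]
    rw [sum_busyState fun s => p (Sum.inr s) * (m + ((s.1 : ℕ) : ℝ))]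
    simp only [Fin.val_zero, Fin.val_one, Nat.cast_zero, Nat.cast_one, ← Finset.sum_mul]
    ring
  rw [h3] at h1
  rw [sum_state_eq, estProb, estProb] at h2
  rw [estProb]
  field_simp
  linear_combination -h1 + δ * m * h2

/-- For a service time of mean one, `(1 - y) / δ` is the probability that its equilibrium excess
ends before a timer with rate `δ` expires; in particular it is at most one. -/
lemma IsCavityLaw.one_sub_finishProb_le (hp : IsCavityLaw α S lam δ m ν p) (h : IsPhaseType α S)
    (hmean : phMean α S = 1) (hδ : 0 < δ) (hlam : 0 < lam) : 1 - finishProb α S δ ≤ δ := by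
  have h1 := hp.stationary.sum_phaseFinishProb h hmean hδ
  have h2 : ∑ s : BusyState m n, p (Sum.inr s) * phaseFinishProb S δ s.2.2 ≤ lam := by
    rw [← hp.sum_busy]
    exact Finset.sum_le_sum fun s _ =>
      mul_le_of_le_one_right (hp.stationary.nonneg _) (h.phaseFinishProb_lt_one hδ _).le
  rw [hp.sum_busy] at h1
  refine le_of_mul_le_mul_right ?_ hlam
  rw [← h1]
  exact mul_le_mul_of_nonneg_left h2 hδ.le

lemma IsStationary.prob_empty_le_estProb (hp : IsStationary (generator α S δ m ν) p) (k : Fin 2) :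
    p (Sum.inl k) ≤ estProb p k :=
  le_add_of_nonneg_right (Finset.sum_nonneg fun _ _ => hp.nonneg _)

/-! ### Thresholds and bounds -/

/-- The denominator of `lamThreshold δ y k`. -/
def thresholdDenom (δ y : ℝ) (k : ℕ) : ℝ := δ * y * (1 - y ^ k) + y ^ k * (1 - y)

lemma thresholdDenom_pos {y : ℝ} (hδ : 0 < δ) (hy0 : 0 < y) (hy1 : y < 1) (k : ℕ) :
    0 < thresholdDenom δ y k := by
  have h1 : 0 ≤ 1 - y ^ k := sub_nonneg.2 (pow_le_one₀ hy0.le hy1.le)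
  have h2 : 0 < 1 - y := sub_pos.2 hy1
  unfold thresholdDenom
  positivity

lemma mul_one_sub_le_thresholdDenom {y : ℝ} (hy0 : 0 < y) (hy1 : y < 1)
    (hyδ : 1 - y ≤ δ) (k : ℕ) : y * (1 - y) ≤ thresholdDenom δ y k := by
  have h1 : 0 ≤ 1 - y ^ k := sub_nonneg.2 (pow_le_one₀ hy0.le hy1.le)
  have h2 : 0 < 1 - y := sub_pos.2 hy1
  have h3 : (1 - y) * (y * (1 - y ^ k)) ≤ δ * (y * (1 - y ^ k)) :=
    mul_le_mul_of_nonneg_right hyδ (by positivity)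
  have h4 : 0 ≤ y ^ k * (1 - y) * (1 - y) := by positivity
  unfold thresholdDenom
  linarith

lemma lamThreshold_mul {y : ℝ} (hδ : 0 < δ) (hy0 : 0 < y) (hy1 : y < 1) (k : ℕ) :
    lamThreshold δ y k * thresholdDenom δ y k = δ * y * (1 - y ^ k) :=
  div_mul_cancel₀ _ (thresholdDenom_pos hδ hy0 hy1 k).ne'

/-- The number `X` with `mTilde lam δ y = log X / log (1 / y)`, that is, `X = y ^ (-m̃)`. -/
def mTildeArg (lam δ y : ℝ) : ℝ := 1 / y + (lam / (δ * (1 - lam)) - 1) * ((1 - y) / y)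

lemma mTildeArg_mul {y : ℝ} (hδ : 0 < δ) (hlam1 : lam < 1) (hy0 : 0 < y) :
    mTildeArg lam δ y * (δ * (1 - lam) * y) = δ * (1 - lam) * y + lam * (1 - y) := by
  have : 1 - lam ≠ 0 := (sub_pos.2 hlam1).ne'
  unfold mTildeArg
  field_simp
  ring

lemma mTildeArg_pos {y : ℝ} (hδ : 0 < δ) (hlam0 : 0 ≤ lam) (hlam1 : lam < 1) (hy0 : 0 < y)
    (hy1 : y < 1) : 0 < mTildeArg lam δ y := by
  have h1 : 0 < 1 - lam := sub_pos.2 hlam1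
  have h2 : 0 < 1 - y := sub_pos.2 hy1
  have h3 : 0 < δ * (1 - lam) * y := by positivity
  refine pos_of_mul_pos_left ?_ h3.le
  rw [mTildeArg_mul hδ hlam1 hy0]
  positivity

lemma log_mTildeArg_sub {y : ℝ} (hX : 0 < mTildeArg lam δ y) (hy0 : 0 < y) (k : ℕ) :
    Real.log (mTildeArg lam δ y * y ^ k) =
      Real.log (mTildeArg lam δ y) - k * Real.log (1 / y) := by
  rw [Real.log_mul hX.ne' (by positivity), Real.log_pow, one_div, Real.log_inv]
  ring

lemma natCast_le_mTilde_iff {y : ℝ} (hX : 0 < mTildeArg lam δ y) (hy0 : 0 < y) (hy1 : y < 1)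
    (k : ℕ) : (k : ℝ) ≤ mTilde lam δ y ↔ 1 ≤ mTildeArg lam δ y * y ^ k := by
  have hL : 0 < Real.log (1 / y) := Real.log_pos (one_lt_one_div hy0 hy1)
  rw [← Real.log_nonneg_iff (by positivity), log_mTildeArg_sub hX hy0, sub_nonneg,
    ← le_div_iff₀ hL]
  rfl

lemma mTilde_le_natCast_iff {y : ℝ} (hX : 0 < mTildeArg lam δ y) (hy0 : 0 < y) (hy1 : y < 1)
    (k : ℕ) : mTilde lam δ y ≤ k ↔ mTildeArg lam δ y * y ^ k ≤ 1 := by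
  have hL : 0 < Real.log (1 / y) := Real.log_pos (one_lt_one_div hy0 hy1)
  rw [← Real.log_nonpos_iff (by positivity), log_mTildeArg_sub hX hy0, sub_nonpos,
    ← div_le_iff₀ hL]
  rfl

end PushCavity

end


theorem mainTheorem6 {n : ℕ} (α : Fin n → ℝ) (S : Matrix (Fin n) (Fin n) ℝ)
    (hPH : PushCavity.IsPhaseType α S) (hmean : PushCavity.phMean α S = 1)
    (lam δ : ℝ) (hlam0 : 0 ≤ lam) (hlam1 : lam < 1) (hδ : 0 < δ)
    (m : ℕ) (ν : ℝ) (p : PushCavity.State m n → ℝ)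
    (hp : PushCavity.IsCavityLaw α S lam δ m ν p) :
    let y : ℝ := PushCavity.finishProb α S δ
    let mt : ℝ := PushCavity.mTilde lam δ y
    (⌊mt⌋₊ : ℝ) - PushCavity.lamThreshold δ y ⌊mt⌋₊ / δ ≤ PushCavity.meanQueue p ∧
      PushCavity.meanQueue p ≤ (⌈mt⌉₊ : ℝ) - PushCavity.lamThreshold δ y ⌈mt⌉₊ / δ := by
  open PushCavity in
  intro y mt
  have hst := hp.stationary
  have hy0 : 0 < y := hPH.finishProb_pos hδ
  have hy1 : y < 1 := hPH.finishProb_lt_one hδ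
  have h1y : 0 < 1 - y := sub_pos.2 hy1
  have h1l : 0 < 1 - lam := sub_pos.2 hlam1
  have hX := mTildeArg_pos hδ hlam0 hlam1 hy0 hy1
  have hXmul := mTildeArg_mul hδ hlam1 hy0
  set X := mTildeArg lam δ y with hXdef
  set a₀ := p (Sum.inl 0) with ha₀
  set b₀ := p (Sum.inl 1) with hb₀
  set a := estProb p 0 with ha
  set b := estProb p 1 with hb
  have ha₀0 : 0 ≤ a₀ := hst.nonneg _
  have hb₀0 : 0 ≤ b₀ := hst.nonneg _
  have hle_a : a₀ ≤ a := hst.prob_empty_le_estProb 0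
  have hle_b : b₀ ≤ b := hst.prob_empty_le_estProb 1
  have hempty : a₀ + b₀ = 1 - lam := by rw [← hp.prob_empty, queueProb_zero]
  have hab : a + b = 1 := by rw [← hst.sum_eq_one, sum_state_eq]
  have hmq : meanQueue p = m - lam / δ + b := hp.meanQueue_eq hPH hmean hδ
  have hbal : δ * (y * a₀ + b₀) = δ * y ^ (m + 1) * (1 - lam) + y ^ m * (1 - y) * lam := by
    have h1 : y * a₀ + b₀ = y ^ (m + 1) * (1 - lam) + y ^ m * (1 - y) / δ * lam := by
      rw [← hempty, ← hp.sum_busy]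
      exact hst.finishProb_balance hPH hmean hδ
    rw [h1]
    field_simp
  -- Together with `a₀ + b₀ = 1 - lam` this determines the probabilities `a₀` and `b₀` of an empty
  -- queue at the estimated lengths `m` and `m + 1`.
  have hb₀D : (lam - lamThreshold δ y m) * thresholdDenom δ y m = δ * (1 - y) * b₀ := by
    rw [sub_mul, lamThreshold_mul hδ hy0 hy1, thresholdDenom]
    linear_combination -hbal + δ * y * hempty
  have ha₀D : (lamThreshold δ y (m + 1) - lam) * thresholdDenom δ y (m + 1) =
      δ * (1 - y) * y * a₀ := by
    rw [sub_mul, lamThreshold_mul hδ hy0 hy1, thresholdDenom]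
    linear_combination y * hbal - δ * y * hempty
  have hb₀X : (X * y ^ m - 1) * (δ * (1 - lam) * y) = δ * (1 - y) * b₀ := by
    linear_combination y ^ m * hXmul - hbal + δ * y * hempty
  have ha₀X : (1 - X * y ^ (m + 1)) * (δ * (1 - lam)) = δ * (1 - y) * a₀ := by
    linear_combination -y ^ m * hXmul + hbal - δ * hempty
  have hm_le : (m : ℝ) ≤ mt := by
    rw [natCast_le_mTilde_iff hX hy0 hy1, ← sub_nonneg]
    refine nonneg_of_mul_nonneg_left ?_ (show 0 < δ * (1 - lam) * y by positivity)
    rw [hb₀X]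
    positivity
  have hle_m : mt ≤ ((m + 1 : ℕ) : ℝ) := by
    rw [mTilde_le_natCast_iff hX hy0 hy1, ← sub_nonneg]
    refine nonneg_of_mul_nonneg_left ?_ (show 0 < δ * (1 - lam) by positivity)
    rw [ha₀X]
    positivity
  have hD := thresholdDenom_pos hδ hy0 hy1 m
  have hD' := thresholdDenom_pos hδ hy0 hy1 (m + 1)
  rcases hm_le.eq_or_lt with hmt | hlt_m
  · -- Here `b₀ = 0`, so that the estimated length is `m` almost surely.
    have hXm : X * y ^ m ≤ 1 := (mTilde_le_natCast_iff hX hy0 hy1 m).1 hmt.ge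
    have hb₀z : b₀ = 0 := by
      have h1 : (X * y ^ m - 1) * (δ * (1 - lam) * y) ≤ 0 :=
        mul_nonpos_of_nonpos_of_nonneg (by linarith) (by positivity)
      have h2 : 0 ≤ δ * (1 - y) * b₀ := by positivity
      have h3 : δ * (1 - y) * b₀ = 0 := by linarith
      exact (mul_eq_zero.1 h3).resolve_left (by positivity)
    have hbz : b = 0 := hst.estProb_eq_zero hPH hδ hp.nu_nonneg hb₀z
    have hlam : lam = lamThreshold δ y m := by
      rw [hb₀z, mul_zero] at hb₀D
      exact sub_eq_zero.1 ((mul_eq_zero.1 hb₀D).resolve_right hD.ne')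
    rw [← hmt, Nat.floor_natCast, Nat.ceil_natCast, hmq, hbz, ← hlam, add_zero]
    exact ⟨le_rfl, le_rfl⟩
  rcases hle_m.eq_or_lt with hmt | hlt_m'
  · -- Here `a₀ = 0`, and the estimated length would be `m + 1` almost surely.
    have hXm : 1 ≤ X * y ^ (m + 1) := (natCast_le_mTilde_iff hX hy0 hy1 (m + 1)).1 hmt.ge
    have ha₀z : a₀ = 0 := by
      have h1 : (1 - X * y ^ (m + 1)) * (δ * (1 - lam)) ≤ 0 :=
        mul_nonpos_of_nonpos_of_nonneg (by linarith) (by positivity)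
      have h2 : 0 ≤ δ * (1 - y) * a₀ := by positivity
      have h3 : δ * (1 - y) * a₀ = 0 := by linarith
      exact (mul_eq_zero.1 h3).resolve_left (by positivity)
    have haz : a = 0 := hst.estProb_eq_zero hPH hδ hp.nu_nonneg ha₀z
    have hlam : lam = lamThreshold δ y (m + 1) := by
      rw [ha₀z, mul_zero] at ha₀D
      exact (sub_eq_zero.1 ((mul_eq_zero.1 ha₀D).resolve_right hD'.ne')).symm
    have hbo : b = 1 := by linarith
    rw [hmt, Nat.floor_natCast, Nat.ceil_natCast, hmq, hbo, ← hlam]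
    push_cast
    exact ⟨by linarith, by linarith⟩
  have hfloor : ⌊mt⌋₊ = m := by
    rw [Nat.floor_eq_iff ((Nat.cast_nonneg m).trans hm_le)]
    exact ⟨hm_le, by exact_mod_cast hlt_m'⟩
  have hceil : ⌈mt⌉₊ = m + 1 := by
    rw [Nat.ceil_eq_iff (by omega)]
    exact ⟨by simpa using hlt_m, hle_m⟩
  -- An arrival rate of zero gives `mt = 0`, contrary to `m < mt`.
  have hlam : 0 < lam := by
    refine hlam0.lt_of_ne' fun h0 => ?_
    have hX1 : X = 1 := by simp [hXdef, mTildeArg, h0]; field_simp; ring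
    have : mt ≤ (0 : ℕ) := (mTilde_le_natCast_iff hX hy0 hy1 0).2 (by simp [← hXdef, hX1])
    have h2 : (0 : ℝ) ≤ m := Nat.cast_nonneg m
    push_cast at this
    linarith
  have hyδ : 1 - y ≤ δ := hp.one_sub_finishProb_le hPH hmean hδ hlam
  rw [hfloor, hceil, hmq]
  have hlow : lam - lamThreshold δ y m ≤ δ * b := by
    refine le_of_mul_le_mul_right ?_ hD
    rw [hb₀D]
    have hkey : (1 - y) * b₀ ≤ b * thresholdDenom δ y m := by
      rcases Nat.eq_zero_or_pos m with hm | hm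
      · have : thresholdDenom δ y m = 1 - y := by simp [thresholdDenom, hm]
        rw [this, mul_comm b]
        exact mul_le_mul_of_nonneg_left hle_b h1y.le
      · have h1 : b₀ ≤ y * b := hst.prob_empty_le_finishProb_mul hPH hδ hm
        have h2 := mul_le_mul_of_nonneg_left h1 h1y.le
        have h3 := mul_le_mul_of_nonneg_left (mul_one_sub_le_thresholdDenom hy0 hy1 hyδ m)
          (hb₀0.trans hle_b)
        linarith
    have := mul_le_mul_of_nonneg_left hkey hδ.le
    linarith
  have hupp : lamThreshold δ y (m + 1) - lam ≤ δ * a := by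
    refine le_of_mul_le_mul_right ?_ hD'
    rw [ha₀D]
    have h1 := mul_le_mul hle_a (mul_one_sub_le_thresholdDenom hy0 hy1 hyδ (m + 1))
      (by positivity) (ha₀0.trans hle_a)
    have := mul_le_mul_of_nonneg_left h1 hδ.le
    linarith
  constructor
  · have : (lam - lamThreshold δ y m) / δ ≤ b := (div_le_iff₀' hδ).2 hlow
    rw [sub_div] at this
    linarith
  · have : (lamThreshold δ y (m + 1) - lam) / δ ≤ a := (div_le_iff₀' hδ).2 hupp
    rw [sub_div] at this
    push_cast
    linarith
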